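/- Let $\alpha\in(1,2]$, $d\ge 1$, and let $\xi=(\xi_1,\dots,\xi_d)$ be a symmetric $\alpha$-stable ($S\alpha S$) random vector in $\mathbb{R}^d$, that is, $\xi$ and $-\xi$ have the same distribution, and for all $a,b>0$ the vectors $a^{1/\alpha}\xi'+b^{1/\alpha}\xi''$ and $(a+b)^{1/\alpha}\xi$ have the same distribution, where $\xi',\xi''$ are independent copies of $\xi$. For a non-empty compact set $K$ let $h(K,u)=\sup\{\langle x,u\rangle: x\in K\}$ be its support function. A non-empty compact convex set $K\subset\mathbb{R}^d$ is an $L_\alpha$-zonoid if there is a finite measure $\sigma$ on the Euclidean unit sphere $\mathbb{S}^{d-1}$ with $h(K,u)=\big(\int_{\mathbb{S}^{d-1}} h([-z,z],u)^\alpha\,\sigma(dz)\big)^{1/\alpha}=\big(\int_{\mathbb{S}^{d-1}} |\langle z,u\rangle|^\alpha\,\sigma(dz)\big)^{1/\alpha}$ for all $u\in\mathbb{R}^d$. Let $K$ be the associated zonoid of $\xi$, i.e. the centred ($K=-K$) $L_\alpha$-zonoid such that $\mathbf{E}\,e^{i\langle\xi,u\rangle}=e^{-h(K,u)^\alpha}$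 for all $u\in\mathbb{R}^d$. The shadow boundary of $K$ in a direction $x$ is $\partial(K+H_x)\cap\partial K$, where $H_x$ is the linear span of $x$ and $\partial$ is the topological boundary in $\mathbb{R}^d$. Let $e_1=(1,0,\dots,0)$. Assume that either $K$ has non-empty interior (equivalently, $\xi$ is full-dimensional: its distribution is not concentrated on a proper linear subspace), or $e_1$ does not belong to the linear span of $K$. Then $\xi_1$ is integrable, and the following are equivalent: 1. $\mathbf{E}(\xi_1\mid\xi_2,\dots,\xi_d)$ is linear in $\xi_2,\dots,\xi_d$, i.e. there are real constants $a_2,\dots,a_d$ with $\mathbf{E}(\xi_1\mid\xi_2,\dots,\xi_d)=a_2\xi_2+\cdots+a_d\xi_d$ almost surely; 2. the shadow boundary of $K$ in direction $e_1$ is a subset of a $(d-1)$-dimensional hyperplane through the origin (a $(d-1)$-dimensional linear subspace) which does not contain $e_1$. -/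

import Mathlib

open MeasureTheory Set
open scoped Pointwise RealInnerProductSpace

namespace SaS

/-- `EuclideanSpace ℝ (Fin d)`, i.e. `ℝ^d` with the Euclidean norm and inner product. -/
abbrev Vec (d : ℕ) : Type := EuclideanSpace ℝ (Fin d)

/-- The random vector `ξ` is symmetric `α`-stable: `ξ` and `-ξ` have the same law and, for all
`a, b > 0`, `a^{1/α} ξ₁ + b^{1/α} ξ₂` and `(a+b)^{1/α} ξ` have the same law, where `ξ₁, ξ₂` are
independent copies of `ξ` (realised as the coordinates of the product of the law with itself). -/
def IsSymmetricStable {Ω : Type*} [MeasurableSpace Ω] {d : ℕ} (α : ℝ) (ξ : Ω → Vec d)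
    (P : Measure Ω) : Prop :=
  (P.map ξ).map (fun x => -x) = P.map ξ ∧
  ∀ a b : ℝ, 0 < a → 0 < b →
    ((P.map ξ).prod (P.map ξ)).map (fun x => a ^ (1 / α) • x.1 + b ^ (1 / α) • x.2) =
      (P.map ξ).map (fun x => (a + b) ^ (1 / α) • x)

/-- The support function `h(K, u) = sup {⟨x, u⟩ : x ∈ K}` (used for nonempty bounded `K`). -/
noncomputable def supportFn {d : ℕ} (K : Set (Vec d)) (u : Vec d) : ℝ :=
  sSup ((fun x : Vec d => ⟪x, u⟫) '' K)

/-- `K` is an `L_p`-zonoid with spectral measure `σ`, a measure on the Euclidean unit sphere: the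
compact convex set `K` is the (rescaled) Firey `p`-expectation of the random segments `[-z, z]`,
that is, `h(K, u) = (∫ h([-z, z], u)^p σ(dz))^{1/p}` for all `u`. -/
def IsLpZonoidWith {d : ℕ} (p : ℝ) (σ : Measure (Metric.sphere (0 : Vec d) 1))
    (K : Set (Vec d)) : Prop :=
  K.Nonempty ∧ IsCompact K ∧ Convex ℝ K ∧
  ∀ u : Vec d, supportFn K u =
    (∫ z, supportFn (segment ℝ (-(z : Vec d)) (z : Vec d)) u ^ p ∂σ) ^ (1 / p)

/-- `K` is an `L_p`-zonoid, with some finite spectral measure on the unit sphere. -/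
def IsLpZonoid {d : ℕ} (p : ℝ) (K : Set (Vec d)) : Prop :=
  ∃ σ : Measure (Metric.sphere (0 : Vec d) 1), IsFiniteMeasure σ ∧ IsLpZonoidWith p σ K

/-- `K` is the associated zonoid of the symmetric `α`-stable vector `ξ`: the centred
`L_α`-zonoid with `E exp(i⟨ξ, u⟩) = exp(-h(K, u)^α)` for all `u`. -/
def IsAssociatedZonoid {Ω : Type*} [MeasurableSpace Ω] {d : ℕ} (α : ℝ) (ξ : Ω → Vec d)
    (P : Measure Ω) (K : Set (Vec d)) : Prop :=
  IsLpZonoid α K ∧ -K = K ∧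
  ∀ u : Vec d, charFun (P.map ξ) u = Complex.exp (-((supportFn K u ^ α : ℝ) : ℂ))

/-- The shadow boundary `∂(K + H_x) ∩ ∂K` of `K` in direction `x`, with `H_x` the linear span
of `x`. -/
def shadowBoundary {d : ℕ} (K : Set (Vec d)) (x : Vec d) : Set (Vec d) :=
  frontier (K + (Submodule.span ℝ {x} : Set (Vec d))) ∩ frontier K

/-- `E(ξ₁ | ξ₂, …, ξ_d)` is linear: almost surely equal to `a₂ ξ₂ + ⋯ + a_d ξ_d` for some real
constants. Here `d = n + 1`, and the coordinates are indexed by `0, …, n`. -/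
def HasLinearRegression {Ω : Type*} [MeasurableSpace Ω] {n : ℕ} (ξ : Ω → Vec (n + 1))
    (P : Measure Ω) : Prop :=
  ∃ a : Fin n → ℝ,
    P[fun ω => ξ ω 0 | MeasurableSpace.comap (fun ω (i : Fin n) => ξ ω i.succ) inferInstance]
      =ᵐ[P] fun ω => ∑ i, a i * ξ ω i.succ

/-- The first vector `e₁ = (1, 0, …, 0)` of the standard basis of `ℝ^{n+1}`. -/
noncomputable def e₁ (n : ℕ) : Vec (n + 1) := EuclideanSpace.single 0 1

end SaS

/-! Regression with coefficients `a` says that, for `v = (1, -a)`, the variable `⟪ξ, v⟫` has zero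
integral over every event generated by `ξ₂, …, ξ_d`. By Fourier uniqueness this means `E[⟪ξ, v⟫
exp(i⟪ξ, w⟫)] = 0` for all `w ⟂ e₁`. Up to the factor `i`, this is the derivative of the
characteristic function `exp(-h(K, ·)^α)` at `w` along `v`, which exists since `α > 1` makes `ξ`
integrable. So the condition is that `h(K, ·)^α` has zero derivative there. If `x ∈ K` maximises
`⟪·, w⟫` and `h(K, w) > 0`, that derivative is `α h(K, w)^(α-1) ⟪x, v⟫`, so it vanishes exactly when
`x ⟂ v`. When `K` has interior, the maximisers for nonzero `w ⟂ e₁` form the shadow boundary, and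
hyperplanes missing `e₁` are the `v^⊥` with `v 0 = 1`. If `e₁` is outside the span of `K`, both
conditions hold. -/

namespace SaS

/-! ### Integrability and differentiation of the characteristic function -/

/-- A random variable whose tail decays like `r ^ (-p)` with `p > 1` is integrable. -/
theorem integrable_of_tail_le {Ω : Type*} [MeasurableSpace Ω] {P : Measure Ω} [IsFiniteMeasure P]
    {Y : Ω → ℝ} (hY : Measurable Y) {p C : ℝ} (hp : 1 < p)
    (h : ∀ r, 0 < r → P.real {ω | r < |Y ω|} ≤ C * r ^ (-p)) : Integrable Y P := by
  refine ⟨hY.aestronglyMeasurable, ?_⟩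
  rw [hasFiniteIntegral_iff_norm]
  simp only [Real.norm_eq_abs]
  rw [lintegral_eq_lintegral_meas_lt P (Filter.Eventually.of_forall fun ω => abs_nonneg _)
    (by fun_prop), ← Ioc_union_Ioi_eq_Ioi (zero_le_one (α := ℝ)),
    lintegral_union measurableSet_Ioi Ioc_disjoint_Ioi_same, ENNReal.add_lt_top]
  constructor
  · calc _ ≤ ∫⁻ _ in Ioc (0 : ℝ) 1, P univ := lintegral_mono fun _ => measure_mono (subset_univ _)
      _ < ⊤ := by
        simp
  · have hI : IntegrableOn (fun r : ℝ => C * r ^ (-p)) (Ioi 1) :=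
      (integrableOn_Ioi_rpow_of_lt (by linarith) zero_lt_one).const_mul C
    refine lt_of_le_of_lt ?_ hI.lintegral_lt_top
    refine setLIntegral_mono' measurableSet_Ioi fun r hr => ?_
    rw [← ofReal_measureReal]
    exact ENNReal.ofReal_le_ofReal (h r (zero_lt_one.trans hr))

/-- The tail beyond `r` is controlled by the integral of `1 - φ` over `|t| ≤ 2/r`, and `1 - exp(-x)
≤ x`. -/
theorem integrable_inner_of_charFun {Ω : Type*} [MeasurableSpace Ω] {P : Measure Ω}
    [IsProbabilityMeasure P] {d : ℕ} {ξ : Ω → Vec d} (hξ : Measurable ξ) {v : Vec d} {p c : ℝ}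
    (hp : 1 < p) (hc : 0 ≤ c)
    (h : ∀ t : ℝ, charFun (P.map ξ) (t • v) = Complex.exp (-((c * |t| ^ p : ℝ) : ℂ))) :
    Integrable (fun ω => ⟪ξ ω, v⟫) P := by
  have : IsProbabilityMeasure (P.map ξ) := Measure.isProbabilityMeasure_map hξ.aemeasurable
  -- The constant is `(r/2) · c(2/r)^p · (4/r) = 2c 2^p r^(-p)`.
  refine integrable_of_tail_le (p := p) (C := 2 * c * 2 ^ p) (by fun_prop) hp fun r hr => ?_
  have h1 := measureReal_abs_inner_gt_le_integral_charFun (μ := P.map ξ) (a := v) hr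
  rw [map_measureReal_apply hξ (measurableSet_lt (by fun_prop) (by fun_prop))] at h1
  have h2 : ξ ⁻¹' {x | r < |⟪v, x⟫|} = {ω | r < |⟪ξ ω, v⟫|} := by
    ext ω; simp [real_inner_comm]
  rw [h2] at h1
  refine h1.trans ?_
  have hr' : 0 < 2 * r⁻¹ := by positivity
  have h3 : ‖∫ t in (-2 * r⁻¹)..(2 * r⁻¹), 1 - charFun (P.map ξ) (t • v)‖ ≤
      (c * (2 * r⁻¹) ^ p) * |2 * r⁻¹ - (-2 * r⁻¹)| := by
    refine intervalIntegral.norm_integral_le_of_norm_le_const fun t ht => ?_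
    rw [uIoc_of_le (by linarith), mem_Ioc] at ht
    have ht' : |t| ≤ 2 * r⁻¹ := abs_le.2 ⟨by linarith, ht.2⟩
    rw [h, ← Complex.ofReal_neg, ← Complex.ofReal_exp, ← Complex.ofReal_one, ← Complex.ofReal_sub,
      Complex.norm_real, Real.norm_eq_abs]
    have h4 : c * |t| ^ p ≤ c * (2 * r⁻¹) ^ p := by gcongr
    have h5 : 0 ≤ c * |t| ^ p := by positivity
    have h6 := Real.add_one_le_exp (-(c * |t| ^ p))
    have h7 : Real.exp (-(c * |t| ^ p)) ≤ 1 := Real.exp_le_one_iff.2 (by linarith)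
    rw [abs_le]; constructor <;> linarith
  calc _ ≤ 2⁻¹ * r * ((c * (2 * r⁻¹) ^ p) * |2 * r⁻¹ - (-2 * r⁻¹)|) := by gcongr
    _ = 2 * c * 2 ^ p * r ^ (-p) := by
      rw [abs_of_pos (by linarith), Real.mul_rpow (by norm_num) (by positivity),
        Real.inv_rpow hr.le, Real.rpow_neg hr.le]
      field_simp
      ring

theorem hasDerivAt_charFun_line {Ω : Type*} [MeasurableSpace Ω] {P : Measure Ω}
    [IsProbabilityMeasure P] {d : ℕ} {ξ : Ω → Vec d} (hξ : Measurable ξ) {v : Vec d} (w : Vec d)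
    (hv : Integrable (fun ω => ⟪ξ ω, v⟫) P) :
    HasDerivAt (fun t : ℝ => charFun (P.map ξ) (w + t • v))
      (Complex.I * ∫ ω, (⟪ξ ω, v⟫ : ℂ) * Complex.exp (⟪ξ ω, w⟫ * Complex.I) ∂P) 0 := by
  have h1 : (fun t : ℝ => charFun (P.map ξ) (w + t • v)) =
      fun t : ℝ => ∫ ω, Complex.exp ((⟪ξ ω, w⟫ + t * ⟪ξ ω, v⟫ : ℂ) * Complex.I) ∂P := by
    ext t
    rw [charFun_apply, integral_map hξ.aemeasurable (by fun_prop)]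
    simp [inner_add_right, inner_smul_right]
  have h2 := (hasDerivAt_integral_of_dominated_loc_of_deriv_le (μ := P) (s := univ) (x₀ := (0 : ℝ))
    (F := fun (t : ℝ) ω => Complex.exp ((⟪ξ ω, w⟫ + t * ⟪ξ ω, v⟫ : ℂ) * Complex.I))
    (F' := fun (t : ℝ) ω => Complex.exp ((⟪ξ ω, w⟫ + t * ⟪ξ ω, v⟫ : ℂ) * Complex.I) *
      (⟪ξ ω, v⟫ * Complex.I))
    (bound := fun ω => |⟪ξ ω, v⟫|) Filter.univ_mem
    (.of_forall fun t => Measurable.aestronglyMeasurable (by fun_prop))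
    (Integrable.of_bound (C := 1) (Measurable.aestronglyMeasurable (by fun_prop))
      (.of_forall fun ω => by
        have := Complex.norm_exp_ofReal_mul_I (⟪ξ ω, w⟫ + (0 : ℝ) * ⟪ξ ω, v⟫)
        push_cast at this
        exact this.le))
    (Measurable.aestronglyMeasurable (by fun_prop))
    (.of_forall fun ω t _ => by
      have := Complex.norm_exp_ofReal_mul_I (⟪ξ ω, w⟫ + t * ⟪ξ ω, v⟫)
      push_cast at this
      rw [norm_mul, this]; simp)
    hv.abs
    (.of_forall fun ω t _ => by
      have h3 : HasDerivAt (fun t : ℝ => (⟪ξ ω, w⟫ + t * ⟪ξ ω, v⟫ : ℂ) * Complex.I)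
          (⟪ξ ω, v⟫ * Complex.I) t := by
        simpa using (((Complex.ofRealCLM.hasDerivAt (x := t)).mul_const
          (⟪ξ ω, v⟫ : ℂ)).const_add (⟪ξ ω, w⟫ : ℂ)).mul_const Complex.I
      exact h3.cexp)).2
  rw [h1]
  convert! h2 using 1
  rw [← integral_const_mul]
  congr 1 with ω
  simp
  ring

/-- If `φ = exp (-g)` with `g` real is differentiable, then so is `g`, and the derivatives vanish
simultaneously. -/
theorem hasDerivAt_of_cexp_neg {f : ℝ → ℂ} {g : ℝ → ℝ} {f' : ℂ}
    (hfg : ∀ t, f t = Complex.exp (-(g t : ℂ))) {x : ℝ} (hf : HasDerivAt f f' x) :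
    ∃ g', HasDerivAt g g' x ∧ (f' = 0 ↔ g' = 0) := by
  have h1 : ∀ t, (f t).re = Real.exp (-g t) := fun t => by
    rw [hfg, ← Complex.ofReal_neg, ← Complex.ofReal_exp, Complex.ofReal_re]
  have h2 : HasDerivAt (fun t => (f t).re) f'.re x := by
    exact Complex.reCLM.hasFDerivAt.comp_hasDerivAt x hf
  have h3 : HasDerivAt g (-(f'.re / (f x).re)) x := by
    have := (h2.log (by rw [h1]; positivity)).neg
    refine this.congr_of_eventuallyEq (.of_forall fun t => ?_)
    simp [h1]
  refine ⟨_, h3, fun h => by simp [h], fun h => ?_⟩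
  -- Differentiating `exp(-g)` back recovers all of `f'`, not only its real part.
  have h4 : HasDerivAt f (Complex.exp (-(g x : ℂ)) * -((-(f'.re / (f x).re) : ℝ) : ℂ)) x := by
    have := (h3.ofReal_comp.neg).cexp
    exact this.congr_of_eventuallyEq (.of_forall hfg)
  rw [hf.unique h4, h]
  simp

/-! ### Fourier uniqueness for a signed law -/

/-- The integrals of `Y` over all events generated by `Z` vanish if and only if the Fourier
transform of the signed law `E[Y; Z ∈ ·]` vanishes. -/
theorem forall_setIntegral_preimage_eq_zero_iff {Ω : Type*} [MeasurableSpace Ω] {P : Measure Ω}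
    [IsFiniteMeasure P] {E : Type*} [NormedAddCommGroup E] [NormedSpace ℝ E] [CompleteSpace E]
    [MeasurableSpace E] [BorelSpace E] [SecondCountableTopology E]
    {Y : Ω → ℝ} {Z : Ω → E} (hY : Measurable Y) (hYi : Integrable Y P) (hZ : Measurable Z) :
    (∀ s, MeasurableSet s → ∫ ω in Z ⁻¹' s, Y ω ∂P = 0) ↔
      ∀ L : StrongDual ℝ E, ∫ ω, (Y ω : ℂ) * Complex.exp (L (Z ω) * Complex.I) ∂P = 0 := by
  have fin : ∀ {Y : Ω → ℝ}, Integrable Y P →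
      IsFiniteMeasure (P.withDensity fun ω => ((Y ω).toNNReal : ENNReal)) := fun h =>
    isFiniteMeasure_withDensity (by
      simpa [ENNReal.ofReal] using h.lintegral_lt_top.ne)
  have hf1 := fin hYi
  have hf2 := fin hYi.neg
  -- The signed law is split into the images of `Y⁺ P` and `Y⁻ P`; both conditions then say `μ₁ =
  -- μ₂`.
  set μ₁ := (P.withDensity fun ω => ((Y ω).toNNReal : ENNReal)).map Z with hμ₁
  set μ₂ := (P.withDensity fun ω => (((-Y) ω).toNNReal : ENNReal)).map Z with hμ₂
  have hsub : ∀ y : ℝ, ((y.toNNReal : ℝ) - ((-y).toNNReal : ℝ)) = y := fun y => by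
    rcases le_total 0 y with h | h
    · rw [Real.coe_toNNReal _ h, Real.toNNReal_of_nonpos (by linarith)]; simp
    · rw [Real.coe_toNNReal _ (by linarith : 0 ≤ -y), Real.toNNReal_of_nonpos h]; simp
  have hint : ∀ {Y : Ω → ℝ}, Integrable Y P → Integrable (fun ω => ((Y ω).toNNReal : ℝ)) P :=
    fun h => by simpa using h.real_toNNReal
  have hset : ∀ s, MeasurableSet s → μ₁.real s - μ₂.real s = ∫ ω in Z ⁻¹' s, Y ω ∂P := by
    have key : ∀ {Y : Ω → ℝ}, Measurable Y → Integrable Y P → ∀ s, MeasurableSet s →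
        ((P.withDensity fun ω => ((Y ω).toNNReal : ENNReal)).map Z).real s =
          ∫ ω in Z ⁻¹' s, ((Y ω).toNNReal : ℝ) ∂P := by
      intro Y hYm hYi s hs
      rw [map_measureReal_apply hZ hs, measureReal_def, withDensity_apply _ (hZ hs),
        integral_eq_lintegral_of_nonneg_ae (.of_forall fun _ => by positivity)
          (by fun_prop)]
      simp only [ENNReal.ofReal_coe_nnreal]
    intro s hs
    rw [key hY hYi s hs, key hY.neg hYi.neg s hs,
      ← integral_sub (hint hYi).integrableOn (hint hYi.neg).integrableOn]
    simp only [Pi.neg_apply, hsub]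
  have hchar : ∀ L, charFunDual μ₁ L - charFunDual μ₂ L =
      ∫ ω, (Y ω : ℂ) * Complex.exp (L (Z ω) * Complex.I) ∂P := by
    have key : ∀ {Y : Ω → ℝ}, Measurable Y → ∀ L : StrongDual ℝ E,
        charFunDual ((P.withDensity fun ω => ((Y ω).toNNReal : ENNReal)).map Z) L =
          ∫ ω, (((Y ω).toNNReal : ℝ) : ℂ) * Complex.exp (L (Z ω) * Complex.I) ∂P := by
      intro Y hYm L
      rw [charFunDual_apply, integral_map hZ.aemeasurable (by fun_prop),
        integral_withDensity_eq_integral_smul (by fun_prop)]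
      rfl
    have hi : ∀ {Y : Ω → ℝ}, Integrable Y P → ∀ L : StrongDual ℝ E, Integrable
        (fun ω => (((Y ω).toNNReal : ℝ) : ℂ) * Complex.exp (L (Z ω) * Complex.I)) P := by
      intro Y hYi L
      refine (hint hYi).ofReal.mul_bdd (c := 1) (Measurable.aestronglyMeasurable (by fun_prop))
        (.of_forall fun ω => (Complex.norm_exp_ofReal_mul_I _).le)
    intro L
    rw [key hY, key hY.neg, ← integral_sub (hi hYi L) (hi hYi.neg L)]
    simp only [Pi.neg_apply, ← sub_mul, ← Complex.ofReal_sub, hsub]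
  constructor
  · intro h L
    have : μ₁ = μ₂ := Measure.ext fun s hs => by
      have := hset s hs
      rw [h s hs, sub_eq_zero] at this
      exact (measureReal_eq_measureReal_iff).1 this
    rw [← hchar, this, sub_self]
  · intro h s hs
    have : μ₁ = μ₂ := Measure.ext_of_charFunDual <| funext fun L => by
      rw [← sub_eq_zero, hchar, h]
    rw [← hset s hs, this, sub_self]

/-! ### Support functions and shadow boundaries -/

section Support

variable {d : ℕ} {K : Set (Vec d)}

theorem inner_le_supportFn (hK : IsCompact K) {x : Vec d} (hx : x ∈ K) (u : Vec d) :
    ⟪x, u⟫ ≤ supportFn K u :=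
  le_csSup (hK.image (by fun_prop)).bddAbove (mem_image_of_mem _ hx)

theorem exists_inner_eq_supportFn (hK : IsCompact K) (hne : K.Nonempty) (u : Vec d) :
    ∃ x ∈ K, ⟪x, u⟫ = supportFn K u :=
  (hK.image (f := fun x : Vec d => ⟪x, u⟫) (by fun_prop)).sSup_mem (hne.image _)

theorem supportFn_smul (hneg : -K = K) (t : ℝ) (u : Vec d) :
    supportFn K (t • u) = |t| * supportFn K u := by
  have hpos : ∀ t : ℝ, 0 ≤ t → supportFn K (t • u) = t * supportFn K u := fun t ht => by
    rw [supportFn, supportFn, ← smul_eq_mul, ← Real.sSup_smul_of_nonneg ht]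
    congr 1
    ext y
    simp [mem_smul_set, inner_smul_right]
  rcases le_total 0 t with ht | ht
  · rw [hpos t ht, abs_of_nonneg ht]
  · rw [abs_of_nonpos ht, ← hpos (-t) (by linarith), supportFn, supportFn]
    congr 1
    conv_lhs => rw [← hneg]
    rw [← image_neg_eq_neg, image_image]
    simp

theorem supportFn_nonneg (hK : IsCompact K) (hne : K.Nonempty) (hneg : -K = K) (u : Vec d) :
    0 ≤ supportFn K u := by
  obtain ⟨x, hx⟩ := hne
  have h1 := inner_le_supportFn hK hx u
  have h2 := inner_le_supportFn hK (x := -x) (by rw [← hneg]; simpa using hx) u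
  rw [inner_neg_left] at h2
  linarith

theorem not_mem_interior_of_isMaxOn_inner {S : Set (Vec d)} {x w : Vec d} (hw : w ≠ 0)
    (hmax : ∀ y ∈ S, ⟪y, w⟫ ≤ ⟪x, w⟫) : x ∉ interior S := by
  intro hx
  have h1 : Filter.Tendsto (fun ε : ℝ => x + ε • w) (nhdsWithin 0 (Ioi 0)) (nhds x) := by
    have : Continuous fun ε : ℝ => x + ε • w := by fun_prop
    simpa using (this.tendsto 0).mono_left nhdsWithin_le_nhds
  obtain ⟨ε, hε, hε0⟩ := ((h1.eventually_mem (mem_interior_iff_mem_nhds.1 hx)).and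
    self_mem_nhdsWithin).exists
  have h2 := hmax _ hε
  rw [inner_add_left, inner_smul_left, real_inner_self_eq_norm_sq] at h2
  have h3 : 0 < ε * ‖w‖ ^ 2 := mul_pos hε0 (by positivity)
  simp at h2
  linarith

/-- If `h(K, u) = 0`, symmetry makes every point of `K`, even an interior one, a maximiser of `⟪·,
u⟫`. -/
theorem supportFn_pos (hK : IsCompact K) (hint : (interior K).Nonempty) (hneg : -K = K)
    {u : Vec d} (hu : u ≠ 0) : 0 < supportFn K u := by
  refine (supportFn_nonneg hK (hint.mono interior_subset) hneg u).lt_of_ne' fun h => ?_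
  obtain ⟨x, hx⟩ := hint
  refine not_mem_interior_of_isMaxOn_inner hu (fun y hy => ?_) hx
  have h1 := inner_le_supportFn hK hy u
  have h2 := inner_le_supportFn hK (x := -x) (by rw [← hneg]; simpa using interior_subset hx) u
  rw [inner_neg_left] at h2
  linarith

/-- If `x` maximises `⟪·, w⟫` over `K`, then any derivative of `h(K, ·)^p` at `w` in direction `v`
is the one obtained from the point `x`. -/
theorem hasDerivAt_supportFn_rpow_unique (hK : IsCompact K) {p : ℝ} (hp : 0 < p) {x v w : Vec d}
    (hx : x ∈ K) (hmax : ⟪x, w⟫ = supportFn K w) (hw : 0 < supportFn K w) {g' : ℝ}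
    (hg : HasDerivAt (fun t : ℝ => supportFn K (w + t • v) ^ p) g' 0) :
    g' = p * supportFn K w ^ (p - 1) * ⟪x, v⟫ := by
  have h1 : HasDerivAt (fun t : ℝ => supportFn K w + t * ⟪x, v⟫) ⟪x, v⟫ 0 := by
    simpa using ((hasDerivAt_id (0 : ℝ)).mul_const ⟪x, v⟫).const_add (supportFn K w)
  have h2 := h1.rpow_const (p := p) (Or.inl (by simpa using hw.ne'))
  have h3 : ∀ᶠ t : ℝ in nhds 0, 0 < supportFn K w + t * ⟪x, v⟫ :=
    h1.continuousAt.eventually_const_lt (by simpa using hw)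
  -- The affine function `⟪x, w + tv⟫` lies below `h(K, w + tv)` and touches it at `t = 0`;
  -- positivity preserves this under the `p`-th power.
  have h4 : IsLocalMin ((fun t : ℝ => supportFn K (w + t • v) ^ p) -
      fun t : ℝ => (supportFn K w + t * ⟪x, v⟫) ^ p) 0 := by
    filter_upwards [h3] with t ht
    have h5 := inner_le_supportFn hK hx (w + t • v)
    rw [inner_add_right, inner_smul_right, hmax] at h5
    have h6 := Real.rpow_le_rpow ht.le h5 hp.le
    simp only [Pi.sub_apply, zero_smul, add_zero, zero_mul, sub_self]
    linarith
  have h7 := h4.hasDerivAt_eq_zero (hg.sub h2)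
  simp only [zero_mul, add_zero] at h7
  linarith

/-- Since `w ⟂ e`, the point `x` still maximises `⟪·, w⟫` over `K + H_e`. -/
theorem mem_shadowBoundary_of_isMaxOn_inner {e x w : Vec d} (hw : w ≠ 0)
    (hwe : ⟪e, w⟫ = 0) (hx : x ∈ K) (hmax : ∀ y ∈ K, ⟪y, w⟫ ≤ ⟪x, w⟫) :
    x ∈ shadowBoundary K e := by
  refine ⟨⟨subset_closure ⟨x, hx, 0, zero_mem _, add_zero x⟩,
    not_mem_interior_of_isMaxOn_inner hw ?_⟩,
    subset_closure hx, not_mem_interior_of_isMaxOn_inner hw hmax⟩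
  rintro _ ⟨y, hy, z, hz, rfl⟩
  obtain ⟨c, rfl⟩ := Submodule.mem_span_singleton.1 hz
  simpa [inner_add_left, inner_smul_left, hwe] using hmax y hy

/-- A functional separating `x` from the interior of `K + H_e` supplies `w`. -/
theorem exists_isMaxOn_inner_of_mem_shadowBoundary (hK : IsCompact K) (hconv : Convex ℝ K)
    (hint : (interior K).Nonempty) {e x : Vec d} (hx : x ∈ shadowBoundary K e) :
    x ∈ K ∧ ∃ w : Vec d, w ≠ 0 ∧ ⟪e, w⟫ = 0 ∧ ∀ y ∈ K, ⟪y, w⟫ ≤ ⟪x, w⟫ := by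
  have hxK : x ∈ K := hK.isClosed.frontier_subset hx.2
  refine ⟨hxK, ?_⟩
  set S : Set (Vec d) := K + (Submodule.span ℝ {e} : Set (Vec d)) with hS
  have hSc : Convex ℝ S := hconv.add (Submodule.convex _)
  have hKS : K ⊆ S := fun y hy => ⟨y, hy, 0, zero_mem _, add_zero y⟩
  have hSi : (interior S).Nonempty := hint.mono (interior_mono hKS)
  obtain ⟨f, hf⟩ := geometric_hahn_banach_open_point hSc.interior isOpen_interior hx.1.2
  have hle : ∀ y ∈ S, f y ≤ f x := fun y hy => by
    have hy' : y ∈ closure (interior S) := by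
      rw [hSc.closure_interior_eq_closure_of_nonempty_interior hSi]
      exact subset_closure hy
    exact closure_minimal (fun z hz => (hf z hz).le) (isClosed_Iic.preimage f.continuous) hy'
  obtain ⟨w, rfl⟩ := (InnerProductSpace.toDual ℝ (Vec d)).surjective f
  simp only [InnerProductSpace.toDual_apply_apply, real_inner_comm _ w] at hf hle
  refine ⟨w, ?_, ?_, fun y hy => hle y (hKS hy)⟩
  · rintro rfl
    obtain ⟨y, hy⟩ := hSi
    simpa using hf y hy
  -- A functional bounded above on the line `x + ℝe` vanishes on `e`.
  · have h1 : ∀ c : ℝ, c * ⟪e, w⟫ ≤ 0 := fun c => by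
      have := hle (x + c • e) ⟨x, hxK, c • e, Submodule.smul_mem _ _
        (Submodule.mem_span_singleton_self e), rfl⟩
      rw [inner_add_left, inner_smul_left] at this
      simpa using this
    have := h1 1
    have := h1 (-1)
    linarith

end Support

/-! ### Hyperplanes missing `e₁` -/

theorem inner_e₁_left {n : ℕ} (w : Vec (n + 1)) : ⟪e₁ n, w⟫ = w 0 := by
  rw [e₁, EuclideanSpace.inner_single_left]
  simp

theorem inner_single_one_right {d : ℕ} (w : Vec d) (j : Fin d) :
    ⟪w, EuclideanSpace.single j 1⟫ = w j := by
  rw [EuclideanSpace.inner_single_right]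
  simp

/-- A subspace of codimension one missing `e₁` is the orthogonal complement of a vector whose
first coordinate equals one. -/
theorem exists_eq_orthogonal_of_e₁_notMem {n : ℕ} (H : Submodule ℝ (Vec (n + 1)))
    (he : e₁ n ∉ H) : ∃ v : Vec (n + 1), v 0 = 1 ∧ ∀ x ∈ H, ⟪x, v⟫ = 0 := by
  -- The witness is the component `q` of `e₁` orthogonal to `H`, rescaled; `q 0 = ⟪e₁, q⟫ = ‖q‖²` is
  -- nonzero.
  have h1 : e₁ n - H.starProjection (e₁ n) ∈ Hᗮ := H.sub_starProjection_mem_orthogonal _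
  set p := H.starProjection (e₁ n) with hp
  set q := e₁ n - p with hq
  have hpH : p ∈ H := Submodule.starProjection_apply_mem _ _
  have hq0 : q ≠ 0 := fun h => he (by rwa [sub_eq_zero.1 h])
  have h2 : q 0 = ‖q‖ ^ 2 := by
    rw [← inner_e₁_left, ← real_inner_self_eq_norm_sq]
    conv_lhs => rw [show e₁ n = p + q by simp [hq]]
    rw [inner_add_left, H.inner_right_of_mem_orthogonal hpH h1, zero_add]
  have h3 : q 0 ≠ 0 := by rw [h2]; positivity
  refine ⟨(q 0)⁻¹ • q, by simp [h3], fun x hx => ?_⟩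
  rw [inner_smul_right, H.inner_right_of_mem_orthogonal hx h1, mul_zero]

theorem exists_hyperplane_orthogonal {n : ℕ} {v : Vec (n + 1)} (hv : v 0 = 1) :
    ∃ H : Submodule ℝ (Vec (n + 1)), Module.finrank ℝ H = n ∧ e₁ n ∉ H ∧
      ∀ x : Vec (n + 1), x ∈ H ↔ ⟪x, v⟫ = 0 := by
  have hv0 : v ≠ 0 := by rintro rfl; simp at hv
  have hmem : ∀ x : Vec (n + 1), x ∈ (ℝ ∙ v)ᗮ ↔ ⟪x, v⟫ = 0 := fun x => by
    rw [Submodule.mem_orthogonal_singleton_iff_inner_left]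
  refine ⟨(ℝ ∙ v)ᗮ, ?_, ?_, hmem⟩
  · have : Fact (Module.finrank ℝ (Vec (n + 1)) = n + 1) := ⟨by simp⟩
    exact Submodule.finrank_orthogonal_span_singleton hv0
  · rw [hmem, inner_e₁_left, hv]
    exact one_ne_zero

/-! ### Regression as a Fourier condition -/

/-- Linear regression in terms of the Fourier transform. -/
theorem hasLinearRegression_iff {Ω : Type*} [MeasurableSpace Ω] {P : Measure Ω}
    [IsProbabilityMeasure P] {n : ℕ} {ξ : Ω → Vec (n + 1)} (hξ : Measurable ξ)
    (hi : ∀ v : Vec (n + 1), Integrable (fun ω => ⟪ξ ω, v⟫) P) :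
    HasLinearRegression ξ P ↔ ∃ v : Vec (n + 1), v 0 = 1 ∧ ∀ w : Vec (n + 1), w 0 = 0 →
      ∫ ω, (⟪ξ ω, v⟫ : ℂ) * Complex.exp (⟪ξ ω, w⟫ * Complex.I) ∂P = 0 := by
  set Z : Ω → Fin n → ℝ := fun ω i => ξ ω i.succ with hZdef
  have hZ : Measurable Z := by fun_prop
  have hinner : ∀ ω (v : Vec (n + 1)), ⟪ξ ω, v⟫ = ξ ω 0 * v 0 + ∑ i : Fin n, Z ω i * v i.succ := by
    intro ω v
    rw [PiLp.inner_apply, Fin.sum_univ_succ]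
    simp [hZdef, mul_comm]
  have hcoord : ∀ j, Integrable (fun ω => ξ ω j) P := fun j => by
    simpa only [inner_single_one_right] using hi (EuclideanSpace.single j 1)
  have hm : MeasurableSpace.comap Z inferInstance ≤ ‹MeasurableSpace Ω› := hZ.comap_le
  have hlin : ∀ a : Fin n → ℝ, Integrable (fun ω => ∑ i, a i * ξ ω i.succ) P := fun a =>
    integrable_finsetSum _ fun i _ => (hcoord i.succ).const_mul (a i)
  have key : ∀ a : Fin n → ℝ,
      (P[fun ω => ξ ω 0 | MeasurableSpace.comap Z inferInstance]
        =ᵐ[P] fun ω => ∑ i, a i * ξ ω i.succ) ↔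
      ∀ s, MeasurableSet s → ∫ ω in Z ⁻¹' s, (ξ ω 0 - ∑ i, a i * ξ ω i.succ) ∂P = 0 := by
    intro a
    constructor
    · intro h s hs
      rw [integral_sub (hcoord 0).integrableOn (hlin a).integrableOn, sub_eq_zero,
        ← setIntegral_condExp hm (hcoord 0) ⟨s, hs, rfl⟩]
      exact setIntegral_congr_ae (hZ hs) (h.mono fun ω hω _ => hω)
    · intro h
      refine (ae_eq_condExp_of_forall_setIntegral_eq hm (hcoord 0)
        (fun s _ _ => (hlin a).integrableOn) ?_ ?_).symm
      · rintro _ ⟨s, hs, rfl⟩ -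
        have := h s hs
        rw [integral_sub (hcoord 0).integrableOn (hlin a).integrableOn] at this
        linarith
      · have h1 : Measurable[MeasurableSpace.comap Z inferInstance] Z := comap_measurable Z
        have h2 : Measurable fun z : Fin n → ℝ => ∑ i, a i * z i := by fun_prop
        exact (h2.comp h1).aestronglyMeasurable
  have key2 : ∀ (a : Fin n → ℝ) (v : Vec (n + 1)), v 0 = 1 → (∀ i : Fin n, v i.succ = -a i) →
      ((P[fun ω => ξ ω 0 | MeasurableSpace.comap Z inferInstance]
        =ᵐ[P] fun ω => ∑ i, a i * ξ ω i.succ) ↔ ∀ w : Vec (n + 1), w 0 = 0 →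
      ∫ ω, (⟪ξ ω, v⟫ : ℂ) * Complex.exp (⟪ξ ω, w⟫ * Complex.I) ∂P = 0) := by
    intro a v hv0 hva
    have hYv : ∀ ω, ξ ω 0 - ∑ i, a i * ξ ω i.succ = ⟪ξ ω, v⟫ := fun ω => by
      rw [hinner, hv0, mul_one, sub_eq_add_neg, ← Finset.sum_neg_distrib]
      congr 1
      refine Finset.sum_congr rfl fun i _ => ?_
      rw [hva, mul_neg, mul_comm]
    rw [key]
    simp only [hYv]
    rw [forall_setIntegral_preimage_eq_zero_iff (by fun_prop) (hi v) hZ]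
    constructor
    · intro h w hw
      have := h (∑ i : Fin n, w i.succ • ContinuousLinearMap.proj i)
      convert this using 5 with ω
      rw [hinner, hw, mul_zero, zero_add]
      simp [mul_comm]
    · intro h L
      -- A functional on `ℝ^n` is represented by a vector with zero first coordinate.
      have := h (WithLp.toLp 2 (Fin.cons 0 fun i => L fun j => if i = j then 1 else 0)) (by simp)
      convert this using 5 with ω
      rw [hinner]
      have hL := L.toLinearMap.pi_apply_eq_sum_univ (Z ω)
      simp only [ContinuousLinearMap.coe_coe, smul_eq_mul] at hL
      rw [hL]
      simp
  constructor
  · rintro ⟨a, ha⟩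
    refine ⟨WithLp.toLp 2 (Fin.cons 1 fun i => -a i), by simp, ?_⟩
    exact (key2 a _ (by simp) (by simp)).1 ha
  · rintro ⟨v, hv0, hv⟩
    exact ⟨fun i => -v i.succ, (key2 _ v hv0 (by simp)).2 hv⟩

end SaS

/-! ### The equivalence -/

theorem mainTheorem10 {Ω : Type*} [MeasurableSpace Ω] (P : Measure Ω) [IsProbabilityMeasure P]
    (n : ℕ) (α : ℝ) (hα₁ : 1 < α) (hα₂ : α ≤ 2)
    (ξ : Ω → SaS.Vec (n + 1)) (hmeas : Measurable ξ) (hξ : SaS.IsSymmetricStable α ξ P)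
    (K : Set (SaS.Vec (n + 1))) (hK : SaS.IsAssociatedZonoid α ξ P K)
    (hfull : (interior K).Nonempty ∨ SaS.e₁ n ∉ Submodule.span ℝ K) :
    Integrable (fun ω => ξ ω 0) P ∧
    (SaS.HasLinearRegression ξ P ↔
      ∃ H : Submodule ℝ (SaS.Vec (n + 1)), Module.finrank ℝ H = n ∧ SaS.e₁ n ∉ H ∧
        SaS.shadowBoundary K (SaS.e₁ n) ⊆ H) := by
  open SaS in
  obtain ⟨⟨σ, -, hne, hcomp, hconv, -⟩, hneg, hchar⟩ := hK
  have hα0 : 0 < α := by linarith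
  have hi : ∀ v : Vec (n + 1), Integrable (fun ω => ⟪ξ ω, v⟫) P := fun v => by
    have h0 := supportFn_nonneg hcomp hne hneg v
    refine integrable_inner_of_charFun hmeas hα₁ (Real.rpow_nonneg h0 α) fun t => ?_
    rw [hchar, supportFn_smul hneg, Real.mul_rpow (abs_nonneg t) h0, mul_comm]
  refine ⟨by simpa only [inner_single_one_right] using hi (EuclideanSpace.single 0 1), ?_⟩
  have hderiv : ∀ v w : Vec (n + 1), ∃ g', HasDerivAt (fun t : ℝ => supportFn K (w + t • v) ^ α) g' 0 ∧
      (∫ ω, (⟪ξ ω, v⟫ : ℂ) * Complex.exp (⟪ξ ω, w⟫ * Complex.I) ∂P = 0 ↔ g' = 0) := fun v w => by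
    obtain ⟨g', h1, h2⟩ := hasDerivAt_of_cexp_neg (fun t : ℝ => hchar (w + t • v))
      (hasDerivAt_charFun_line hmeas w (hi v))
    exact ⟨g', h1, by rw [← h2]; simp⟩
  rw [hasLinearRegression_iff hmeas hi]
  rcases hfull with hint | hspan
  · constructor
    · rintro ⟨v, hv0, hv⟩
      obtain ⟨H, hH, he, hmem⟩ := exists_hyperplane_orthogonal hv0
      refine ⟨H, hH, he, fun x hx => (hmem x).2 ?_⟩
      obtain ⟨hxK, w, hw, hwe, hmax⟩ :=
        exists_isMaxOn_inner_of_mem_shadowBoundary hcomp hconv hint hx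
      have hpos := supportFn_pos hcomp hint hneg hw
      obtain ⟨y, hy, hyw⟩ := exists_inner_eq_supportFn hcomp hne w
      have hxw : ⟪x, w⟫ = supportFn K w :=
        le_antisymm (inner_le_supportFn hcomp hxK w) (hyw ▸ hmax y hy)
      obtain ⟨g', hg, hiff⟩ := hderiv v w
      have h1 := hasDerivAt_supportFn_rpow_unique hcomp hα0 hxK hxw hpos hg
      rw [hiff.1 (hv w (by rwa [← inner_e₁_left])), eq_comm] at h1
      exact (mul_eq_zero.1 h1).resolve_left (by positivity)
    · rintro ⟨H, -, he, hsub⟩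
      obtain ⟨v, hv0, hvH⟩ := exists_eq_orthogonal_of_e₁_notMem H he
      refine ⟨v, hv0, fun w hw0 => ?_⟩
      obtain ⟨g', hg, hiff⟩ := hderiv v w
      rw [hiff]
      rcases eq_or_ne w 0 with rfl | hw
      -- At `w = 0` the support-point formula fails because `h(K, 0) = 0`, but there `h^α ≥ 0`
      -- attains its minimum.
      · have hmin : IsLocalMin (fun t : ℝ => supportFn K (0 + t • v) ^ α) 0 :=
          .of_forall fun t => by
            have h1 : supportFn K (0 : Vec (n + 1)) = 0 := by
              simpa using supportFn_smul hneg 0 (0 : Vec (n + 1))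
            simp only [zero_smul, add_zero, h1, Real.zero_rpow hα0.ne']
            exact Real.rpow_nonneg (supportFn_nonneg hcomp hne hneg _) _
        exact hmin.hasDerivAt_eq_zero hg
      · obtain ⟨x, hxK, hxw⟩ := exists_inner_eq_supportFn hcomp hne w
        have hxs := mem_shadowBoundary_of_isMaxOn_inner (e := e₁ n) hw
          (by rw [inner_e₁_left, hw0]) hxK fun y hy => hxw ▸ inner_le_supportFn hcomp hy w
        rw [hasDerivAt_supportFn_rpow_unique hcomp hα0 hxK hxw
          (supportFn_pos hcomp hint hneg hw) hg, hvH x (hsub hxs), mul_zero]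
  -- With `v ⟂ K`, `h(K, ·)` is constant along `v` and `K` lies in `v^⊥`, so both sides are true.
  · obtain ⟨v, hv0, hvK⟩ := exists_eq_orthogonal_of_e₁_notMem _ hspan
    refine iff_of_true ⟨v, hv0, fun w _ => ?_⟩ ?_
    · obtain ⟨g', hg, hiff⟩ := hderiv v w
      have hconst : ∀ t : ℝ, supportFn K (w + t • v) = supportFn K w := fun t => by
        refine congrArg sSup (image_congr fun x hx => ?_)
        rw [inner_add_right, inner_smul_right, hvK x (Submodule.subset_span hx), mul_zero,
          add_zero]
      simp only [hconst] at hg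
      exact hiff.2 (hg.unique (hasDerivAt_const _ _))
    · obtain ⟨H, hH, he, hmem⟩ := exists_hyperplane_orthogonal hv0
      exact ⟨H, hH, he, fun x hx => (hmem x).2
        (hvK x (Submodule.subset_span (hcomp.isClosed.frontier_subset hx.2)))⟩
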